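/- Let $m,p\ge 1$ be integers, and let $a_n,b_n\in\mathbb C^{m\times m}$ $(n\in\mathbb Z)$ satisfy $a_{n+p}=a_n$, $b_{n+p}=b_n$ and $b_n=b_n^*$ for all $n\in\mathbb Z$. Let $\mathcal J$ be the bounded self-adjoint operator on $\ell^2(\mathbb Z,\mathbb C^m)$ given by $$(\mathcal J y)_n=a_{n-1}^*y_{n-1}+b_ny_n+a_ny_{n+1},\qquad n\in\mathbb Z .$$ Then the Lebesgue measure of its spectrum $\sigma(\mathcal J)\subset\mathbb R$ satisfies $$\operatorname{mes}(\sigma(\mathcal J))\le 4\min_{n\in\mathbb Z}\operatorname{Tr}\big((a_n^*a_n)^{1/2}\big),$$ where $(a_n^*a_n)^{1/2}$ is the positive semidefinite square root of the matrix $a_n^*a_n$. This bound is sharp for every $m$: equality holds if, for all $n$, $a_n=I_m$ is the identity matrix and $b_n=\operatorname{diag}(4k)_{k=1}^m=\operatorname{diag}(4,8,\dots,4m)$. -/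

import Mathlib

open MeasureTheory
open scoped ENNReal Matrix MatrixOrder

/-- The Hilbert space `ℓ²(ℤ, ℂᵐ)` of square-summable sequences `(yₙ)`, `n ∈ ℤ`, of vectors of the
Euclidean space `ℂᵐ`. -/
abbrev SeqSpace (m : ℕ) : Type := lp (fun _ : ℤ => EuclideanSpace ℂ (Fin m)) 2

theorem Function.Periodic.exists_norm_le {V : Type*} [NormedAddCommGroup V] {T : ℤ → V} {p : ℕ}
    (hp : 0 < p) (hT : Function.Periodic T (p : ℤ)) : ∃ C, ∀ n, ‖T n‖ ≤ C := by
  refine ⟨∑ i ∈ Finset.range p, ‖T (i : ℤ)‖, fun n => ?_⟩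
  have hp' : (0 : ℤ) < p := by exact_mod_cast hp
  have h1 : T n = T ((n % (p : ℤ)).toNat : ℤ) := by
    rw [Int.toNat_of_nonneg (Int.emod_nonneg n hp'.ne'), Int.emod_def, mul_comm]
    simpa using (hT.sub_zsmul_eq (x := n) (n / (p : ℤ))).symm
  rw [h1]
  refine Finset.single_le_sum (f := fun i : ℕ => ‖T (i : ℤ)‖) (fun i _ => norm_nonneg _) ?_
  have := Int.emod_lt_of_pos n hp'
  have := Int.emod_nonneg n hp'.ne'
  simp only [Finset.mem_range]
  omega

theorem summable_weightedShift {m : ℕ}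
    {T : ℤ → (EuclideanSpace ℂ (Fin m) →L[ℂ] EuclideanSpace ℂ (Fin m))} (k : ℤ) {C : ℝ}
    (hC : ∀ n, ‖T n‖ ≤ C) (y : SeqSpace m) :
    Summable (fun n => ‖T n (y (n + k))‖ ^ (2 : ℝ)) ∧
      ∑' n, ‖T n (y (n + k))‖ ^ (2 : ℝ) ≤ (C * ‖y‖) ^ (2 : ℝ) := by
  have hC0 : 0 ≤ C := (norm_nonneg _).trans (hC 0)
  have h2 : (0 : ℝ) < (2 : ℝ≥0∞).toReal := by norm_num
  have hs := lp.hasSum_norm h2 y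
  have hs' := ((Equiv.addRight k).hasSum_iff.mpr hs).mul_left (C ^ (2 : ℝ))
  simp only [ENNReal.toReal_ofNat] at hs'
  have hle : ∀ n, ‖T n (y (n + k))‖ ^ (2 : ℝ) ≤
      C ^ (2 : ℝ) * ((fun n => ‖y n‖ ^ (2 : ℝ)) ∘ (Equiv.addRight k)) n := by
    intro n
    simp only [Function.comp_apply, Equiv.coe_addRight]
    rw [← Real.mul_rpow hC0 (norm_nonneg _)]
    exact Real.rpow_le_rpow (norm_nonneg _)
      ((T n).le_of_opNorm_le (hC n) _) (by norm_num)
  have hsum : Summable (fun n => ‖T n (y (n + k))‖ ^ (2 : ℝ)) :=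
    Summable.of_nonneg_of_le (fun n => by positivity) hle hs'.summable
  refine ⟨hsum, ?_⟩
  rw [Real.mul_rpow hC0 (norm_nonneg _)]
  exact (hsum.tsum_le_tsum hle hs'.summable).trans_eq hs'.tsum_eq

/-- For a bounded sequence `T n` of operators on `ℂᵐ` and `k ∈ ℤ`, the bounded operator on
`ℓ²(ℤ, ℂᵐ)` that sends `y` to the sequence `n ↦ T n (y (n + k))`. -/
noncomputable def weightedShift {m : ℕ}
    (T : ℤ → (EuclideanSpace ℂ (Fin m) →L[ℂ] EuclideanSpace ℂ (Fin m))) (k : ℤ)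
    (hT : ∃ C, ∀ n, ‖T n‖ ≤ C) : SeqSpace m →L[ℂ] SeqSpace m :=
  LinearMap.mkContinuousOfExistsBound
    { toFun := fun y => ⟨fun n => T n (y (n + k)), by
        obtain ⟨C, hC⟩ := hT
        exact memℓp_gen (by simpa using (summable_weightedShift k hC y).1)⟩
      map_add' := fun y z => by ext n : 2; simp; rfl
      map_smul' := fun c y => by ext n : 2; simp }
    (by
      obtain ⟨C, hC⟩ := hT
      refine ⟨C, fun y => ?_⟩
      have hC0 : 0 ≤ C := (norm_nonneg _).trans (hC 0)
      refine lp.norm_le_of_tsum_le (by norm_num) (by positivity) ?_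
      simpa using (summable_weightedShift k hC y).2)

@[simp]
theorem weightedShift_apply {m : ℕ}
    (T : ℤ → (EuclideanSpace ℂ (Fin m) →L[ℂ] EuclideanSpace ℂ (Fin m))) (k : ℤ)
    (hT : ∃ C, ∀ n, ‖T n‖ ≤ C) (y : SeqSpace m) (n : ℤ) :
    weightedShift T k hT y n = T n (y (n + k)) := rfl

/-- The `p`-periodic Jacobi operator `J` on `ℓ²(ℤ, ℂᵐ)` with coefficients `aₙ, bₙ ∈ ℂᵐˣᵐ`,
`(J y)ₙ = aₙ₋₁* yₙ₋₁ + bₙ yₙ + aₙ yₙ₊₁` (see `jacobiOperator_apply`). It is self-adjoint if all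
`bₙ` are Hermitian (see `isSelfAdjoint_jacobiOperator`). -/
noncomputable def jacobiOperator {m : ℕ} (p : ℕ) (hp : 0 < p)
    (a b : ℤ → Matrix (Fin m) (Fin m) ℂ)
    (ha : Function.Periodic a (p : ℤ)) (hb : Function.Periodic b (p : ℤ)) :
    SeqSpace m →L[ℂ] SeqSpace m :=
  weightedShift (fun n => Matrix.toEuclideanCLM (𝕜 := ℂ) (a (n - 1))ᴴ) (-1)
      (Function.Periodic.exists_norm_le hp fun n => by
        rw [show n + (p : ℤ) - 1 = n - 1 + p by ring, ha (n - 1)]) +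
    weightedShift (fun n => Matrix.toEuclideanCLM (𝕜 := ℂ) (b n)) 0
      (Function.Periodic.exists_norm_le hp fun n => by rw [hb n]) +
    weightedShift (fun n => Matrix.toEuclideanCLM (𝕜 := ℂ) (a n)) 1
      (Function.Periodic.exists_norm_le hp fun n => by rw [ha n])

theorem jacobiOperator_apply {m : ℕ} (p : ℕ) (hp : 0 < p)
    (a b : ℤ → Matrix (Fin m) (Fin m) ℂ)
    (ha : Function.Periodic a (p : ℤ)) (hb : Function.Periodic b (p : ℤ))
    (y : SeqSpace m) (n : ℤ) :
    (jacobiOperator p hp a b ha hb y n).ofLp =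
      (a (n - 1))ᴴ *ᵥ (y (n - 1)).ofLp + b n *ᵥ (y n).ofLp + a n *ᵥ (y (n + 1)).ofLp := by
  simp [jacobiOperator, sub_eq_add_neg]

theorem inner_weightedShift {m : ℕ}
    (T S : ℤ → (EuclideanSpace ℂ (Fin m) →L[ℂ] EuclideanSpace ℂ (Fin m))) (k : ℤ)
    (hT : ∃ C, ∀ n, ‖T n‖ ≤ C) (hS : ∃ C, ∀ n, ‖S n‖ ≤ C)
    (hTS : ∀ n, S (n + k) = star (T n)) (y z : SeqSpace m) :
    inner ℂ (weightedShift T k hT y) z = inner ℂ y (weightedShift S (-k) hS z) := by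
  rw [lp.inner_eq_tsum, lp.inner_eq_tsum,
    ← (Equiv.addRight k).tsum_eq (fun n => inner ℂ (y n) (weightedShift S (-k) hS z n))]
  refine tsum_congr fun n => ?_
  simp [hTS, ContinuousLinearMap.star_eq_adjoint, ContinuousLinearMap.adjoint_inner_right]

theorem isSelfAdjoint_jacobiOperator {m : ℕ} (p : ℕ) (hp : 0 < p)
    (a b : ℤ → Matrix (Fin m) (Fin m) ℂ)
    (ha : Function.Periodic a (p : ℤ)) (hb : Function.Periodic b (p : ℤ))
    (hb' : ∀ n, (b n).IsHermitian) : IsSelfAdjoint (jacobiOperator p hp a b ha hb) := by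
  rw [ContinuousLinearMap.isSelfAdjoint_iff_isSymmetric]
  intro y z
  simp only [jacobiOperator, ContinuousLinearMap.coe_coe, add_apply,
    inner_add_left, inner_add_right]
  rw [inner_weightedShift (fun n => Matrix.toEuclideanCLM (𝕜 := ℂ) (a (n - 1))ᴴ)
      (fun n => Matrix.toEuclideanCLM (𝕜 := ℂ) (a n)) (-1) _
      (Function.Periodic.exists_norm_le hp fun n => by rw [ha n])
      (fun n => by rw [← map_star, Matrix.star_eq_conjTranspose,
        Matrix.conjTranspose_conjTranspose, sub_eq_add_neg]),
    inner_weightedShift (fun n => Matrix.toEuclideanCLM (𝕜 := ℂ) (b n))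
      (fun n => Matrix.toEuclideanCLM (𝕜 := ℂ) (b n)) 0 _
      (Function.Periodic.exists_norm_le hp fun n => by rw [hb n])
      (fun n => by rw [← map_star, Matrix.star_eq_conjTranspose, (hb' n).eq, add_zero]),
    inner_weightedShift (fun n => Matrix.toEuclideanCLM (𝕜 := ℂ) (a n))
      (fun n => Matrix.toEuclideanCLM (𝕜 := ℂ) (a (n - 1))ᴴ) 1 _
      (Function.Periodic.exists_norm_le hp fun n => by
        rw [show n + (p : ℤ) - 1 = n - 1 + p by ring, ha (n - 1)])
      (fun n => by rw [← map_star, Matrix.star_eq_conjTranspose, add_sub_cancel_right])]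
  simp only [neg_neg, neg_zero]
  ring

/-- The Lebesgue measure of the spectrum of an operator on `ℓ²(ℤ, ℂᵐ)` whose spectrum is real,
such as a self-adjoint operator. -/
noncomputable def spectrumMeasure {m : ℕ} (J : SeqSpace m →L[ℂ] SeqSpace m) : ℝ≥0∞ :=
  volume {x : ℝ | (x : ℂ) ∈ spectrum ℂ J}

/-- `Tr ((A* A)^{1/2})`, where `(A* A)^{1/2}` is the positive semidefinite square root of
`A* A`; this trace is a nonnegative real number. -/
noncomputable def traceAbs {m : ℕ} (A : Matrix (Fin m) (Fin m) ℂ) : ℝ :=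
  (Matrix.trace (CFC.sqrt (Aᴴ * A))).re

/-!
Factor one coupling as `aₙ = x* y` with `x x* = y* y = |aₙ|`, and cut the line into cells of `p`
sites at the bonds congruent to `n`. Then `J = π G + (π (X* Y) u + h.c.)`, where `π` lets a
finite matrix act on every cell, `u` is the shift by `p`, and `X`, `Y` carry `x`, `y`. Completing
squares gives `π (G - D) ≤ J ≤ π (G + D)` with `D = X* X + Y* Y`, so that `Tr D = 2 Tr |aₙ|`.

If `t` lies in none of the intervals between the `j`-th eigenvalues of `G - D` and `G + D`, then
the spectral subspace of `G - D` above `t` and that of `G + D` below `t` are complementary. Thus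
`J - t` is uniformly positive on one and uniformly negative on the other of two complementary
subspaces, hence invertible: the intervals cover the spectrum, and their total length is at most
`2 Tr D`.

In the extremal case, `J` is a direct sum of free Jacobi operators translated by `4, 8, …, 4m`,
whose spectra are adjacent intervals of length `4`; a Green function inside them cannot decay.
-/

section SpectralSubspaces

variable {𝕜 E : Type*} [RCLike 𝕜] [NormedAddCommGroup E] [InnerProductSpace 𝕜 E]

theorem re_inner_le_re_inner_of_le {S T : E →ₗ[𝕜] E} (hST : S ≤ T) (v : E) :
    RCLike.re (inner 𝕜 (S v) v) ≤ RCLike.re (inner 𝕜 (T v) v) := by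
  have h := LinearMap.IsPositive.re_inner_nonneg_left (T := T - S) hST v
  rwa [LinearMap.sub_apply, inner_sub_left, map_sub, sub_nonneg] at h

section Eigenbasis

variable {ι : Type*} [Fintype ι] (b : OrthonormalBasis ι 𝕜 E) {T : E →ₗ[𝕜] E} {μ : ι → ℝ}

theorem re_inner_eq_sum_of_eigenbasis (hb : ∀ i, T (b i) = (μ i : 𝕜) • b i) (v : E) :
    RCLike.re (inner 𝕜 (T v) v) = ∑ i, μ i * ‖inner 𝕜 (b i) v‖ ^ 2 := by
  have hTv : T v = ∑ i, inner 𝕜 (b i) v • (μ i : 𝕜) • b i := by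
    conv_lhs => rw [← b.sum_repr' v]
    simp only [map_sum, map_smul, hb]
  simp only [hTv, sum_inner, inner_smul_left, RCLike.conj_ofReal, map_sum]
  refine Finset.sum_congr rfl fun i _ => ?_
  rw [mul_left_comm, RCLike.conj_mul, RCLike.re_ofReal_mul, ← RCLike.ofReal_pow,
    RCLike.ofReal_re]

theorem mul_norm_sq_le_re_inner_of_mem_span (hb : ∀ i, T (b i) = (μ i : 𝕜) • b i) {s : Set ι}
    {c : ℝ} (hc : ∀ i ∈ s, c ≤ μ i) {v : E} (hv : v ∈ Submodule.span 𝕜 (b '' s)) :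
    c * ‖v‖ ^ 2 ≤ RCLike.re (inner 𝕜 (T v) v) := by
  rw [re_inner_eq_sum_of_eigenbasis b hb, ← b.sum_sq_norm_inner_right, Finset.mul_sum]
  refine Finset.sum_le_sum fun i _ => ?_
  by_cases hi : i ∈ s
  · exact mul_le_mul_of_nonneg_right (hc i hi) (by positivity)
  · rw [← b.coe_toBasis, b.toBasis.mem_span_image] at hv
    have hzero : inner 𝕜 (b i) v = 0 := by
      simpa [b.repr_apply_apply] using Finsupp.notMem_support_iff.1 fun h => hi (hv h)
    simp [hzero]

theorem re_inner_le_mul_norm_sq_of_mem_span (hb : ∀ i, T (b i) = (μ i : 𝕜) • b i) {s : Set ι}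
    {c : ℝ} (hc : ∀ i ∈ s, μ i ≤ c) {v : E} (hv : v ∈ Submodule.span 𝕜 (b '' s)) :
    RCLike.re (inner 𝕜 (T v) v) ≤ c * ‖v‖ ^ 2 := by
  have h := mul_norm_sq_le_re_inner_of_mem_span b (T := -T) (μ := -μ) (by simp [hb])
    (c := -c) (fun i hi => neg_le_neg (hc i hi)) hv
  simpa using h

theorem finrank_span_orthonormalBasis_image (s : Finset ι) :
    Module.finrank 𝕜 (Submodule.span 𝕜 (b '' s)) = s.card := by
  classical
  rw [← Finset.coe_image, finrank_span_finset_eq_card,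
    Finset.card_image_of_injective _ b.orthonormal.linearIndependent.injective]
  rw [Finset.coe_image]
  exact b.orthonormal.linearIndependent.linearIndepOn_id.mono (Set.image_subset_range _ _)

end Eigenbasis

variable [FiniteDimensional 𝕜 E] {S T : E →ₗ[𝕜] E} (hS : S.IsSymmetric) (hT : T.IsSymmetric)
  {n : ℕ} (hn : Module.finrank 𝕜 E = n)

theorem eigenvalues_le_eigenvalues_of_le (hST : S ≤ T) (j : Fin n) :
    hS.eigenvalues hn j ≤ hT.eigenvalues hn j := by
  by_contra! hlt
  let U := Submodule.span 𝕜 (hS.eigenvectorBasis hn '' (Finset.Iic j : Finset (Fin n)))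
  let V := Submodule.span 𝕜 (hT.eigenvectorBasis hn '' (Finset.Ici j : Finset (Fin n)))
  have hdisj : Disjoint U V := by
    rw [Submodule.disjoint_def]
    intro v hvU hvV
    have hU := mul_norm_sq_le_re_inner_of_mem_span _ (hS.apply_eigenvectorBasis hn)
      (fun i hi => hS.eigenvalues_antitone hn (Finset.mem_Iic.1 hi)) hvU
    have hV := re_inner_le_mul_norm_sq_of_mem_span _ (hT.apply_eigenvectorBasis hn)
      (fun i hi => hT.eigenvalues_antitone hn (Finset.mem_Ici.1 hi)) hvV
    have hle := hU.trans ((re_inner_le_re_inner_of_le hST v).trans hV)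
    by_contra hv
    exact hle.not_gt (mul_lt_mul_of_pos_right hlt (by positivity))
  have hdim := Submodule.finrank_add_finrank_le_of_disjoint hdisj
  simp only [U, V, finrank_span_orthonormalBasis_image, Fin.card_Iic, Fin.card_Ici, hn] at hdim
  omega

theorem exists_isCompl_of_forall_notMem_Icc_eigenvalues (hST : S ≤ T) {x : ℝ}
    (hx : ∀ j, x ∉ Set.Icc (hS.eigenvalues hn j) (hT.eigenvalues hn j)) :
    ∃ U V : Submodule 𝕜 E, IsCompl U V ∧ ∃ δ > 0,
      (∀ v ∈ U, (x + δ) * ‖v‖ ^ 2 ≤ RCLike.re (inner 𝕜 (S v) v)) ∧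
      ∀ v ∈ V, RCLike.re (inner 𝕜 (T v) v) ≤ (x - δ) * ‖v‖ ^ 2 := by
  obtain ⟨δ, hgap, hδ⟩ : ∃ δ : ℝ, (∀ j, x + δ ≤ hS.eigenvalues hn j ∨
      hT.eigenvalues hn j ≤ x - δ) ∧ 0 < δ := by
    have hev : ∀ᶠ δ in nhdsWithin (0 : ℝ) (Set.Ioi 0), ∀ j,
        x + δ ≤ hS.eigenvalues hn j ∨ hT.eigenvalues hn j ≤ x - δ := by
      refine Filter.eventually_all.2 fun j => ?_
      rcases not_and_or.1 (hx j) with h | h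
      · filter_upwards [Ioo_mem_nhdsGT (sub_pos.2 (not_le.1 h))] with δ hδ
        exact .inl (by linarith [hδ.2])
      · filter_upwards [Ioo_mem_nhdsGT (sub_pos.2 (not_le.1 h))] with δ hδ
        exact .inr (by linarith [hδ.2])
    exact (hev.and self_mem_nhdsWithin).exists
  let I : Finset (Fin n) := {j | x + δ ≤ hS.eigenvalues hn j}
  let U := Submodule.span 𝕜 (hS.eigenvectorBasis hn '' I)
  let V := Submodule.span 𝕜 (hT.eigenvectorBasis hn '' (Iᶜ : Finset (Fin n)))
  have hU : ∀ v ∈ U, (x + δ) * ‖v‖ ^ 2 ≤ RCLike.re (inner 𝕜 (S v) v) := fun v hv =>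
    mul_norm_sq_le_re_inner_of_mem_span _ (hS.apply_eigenvectorBasis hn) (by simp [I]) hv
  have hV : ∀ v ∈ V, RCLike.re (inner 𝕜 (T v) v) ≤ (x - δ) * ‖v‖ ^ 2 := fun v hv =>
    re_inner_le_mul_norm_sq_of_mem_span _ (hT.apply_eigenvectorBasis hn)
      (fun j hj => (hgap j).resolve_left (by simpa [I] using hj)) hv
  have hdisj : Disjoint U V := by
    rw [Submodule.disjoint_def]
    intro v hvU hvV
    by_contra hv
    have : 0 < δ * ‖v‖ ^ 2 := by positivity
    linarith [hU v hvU, re_inner_le_re_inner_of_le hST v, hV v hvV]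
  refine ⟨U, V, ⟨hdisj, codisjoint_iff.2 (Submodule.eq_top_of_disjoint U V ?_ hdisj)⟩, δ, hδ,
    hU, hV⟩
  rw [finrank_span_orthonormalBasis_image, finrank_span_orthonormalBasis_image,
    Finset.card_add_card_compl, Fintype.card_fin, hn]

end SpectralSubspaces

section MatrixSplitting

variable {𝕜 κ : Type*} [RCLike 𝕜] [Fintype κ] [DecidableEq κ]

theorem toEuclideanLin_le_toEuclideanLin_iff {S T : Matrix κ κ 𝕜} :
    S.toEuclideanLin ≤ T.toEuclideanLin ↔ S ≤ T := by
  rw [LinearMap.le_def, ← map_sub, Matrix.isPositive_toEuclideanLin_iff, Matrix.le_iff]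

theorem conjTranspose_mul_mul_nonneg {M : Matrix κ κ 𝕜} (hM : M.IsHermitian) (Q : Matrix κ κ 𝕜)
    (h : ∀ v, 0 ≤ RCLike.re
      (inner 𝕜 (M.toEuclideanLin (Q.toEuclideanLin v)) (Q.toEuclideanLin v))) :
    0 ≤ Qᴴ * M * Q := by
  rw [← toEuclideanLin_le_toEuclideanLin_iff, map_zero, LinearMap.nonneg_iff_isPositive]
  refine ⟨Matrix.isSymmetric_toEuclideanLin_iff.2
    (Matrix.isHermitian_conjTranspose_mul_mul Q hM), fun v => ?_⟩
  rw [Matrix.toLpLin_mul_same, Matrix.toLpLin_mul_same,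
    Matrix.toEuclideanLin_conjTranspose_eq_adjoint]
  simpa only [LinearMap.comp_apply, LinearMap.adjoint_inner_left] using h v

theorem isHermitian_algebraMap_real (c : ℝ) : (algebraMap ℝ (Matrix κ κ 𝕜) c).IsHermitian :=
  (IsSelfAdjoint.algebraMap (Matrix κ κ 𝕜) (.all c)).isHermitian

theorem re_inner_toEuclideanLin_sub_algebraMap (M : Matrix κ κ 𝕜) (c : ℝ)
    (v : EuclideanSpace 𝕜 κ) :
    RCLike.re (inner 𝕜 ((M - algebraMap ℝ _ c).toEuclideanLin v) v) =
      RCLike.re (inner 𝕜 (M.toEuclideanLin v) v) - c * ‖v‖ ^ 2 := by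
  have hc : (algebraMap ℝ (Matrix κ κ 𝕜) c).toEuclideanLin v = (c : 𝕜) • v := by
    ext i
    simp [Matrix.algebraMap_eq_diagonal, Matrix.mulVec_diagonal, RCLike.real_smul_eq_coe_mul]
  rw [map_sub, LinearMap.sub_apply, inner_sub_left, map_sub, hc, inner_smul_left,
    RCLike.conj_ofReal, RCLike.re_ofReal_mul, inner_self_eq_norm_sq]

variable {S T : Matrix κ κ 𝕜} (hS : S.IsHermitian) (hT : T.IsHermitian)

theorem matrix_eigenvalues_le_eigenvalues_of_le (hST : S ≤ T) (j : κ) :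
    hS.eigenvalues j ≤ hT.eigenvalues j :=
  eigenvalues_le_eigenvalues_of_le _ _ _ (toEuclideanLin_le_toEuclideanLin_iff.2 hST) _

theorem exists_splitting_of_forall_notMem_Icc_eigenvalues (hST : S ≤ T) {x : ℝ}
    (hx : ∀ j, x ∉ Set.Icc (hS.eigenvalues j) (hT.eigenvalues j)) :
    ∃ Q : Matrix κ κ 𝕜, ∃ δ > 0, 0 ≤ Qᴴ * (S - algebraMap ℝ _ (x + δ)) * Q ∧
      0 ≤ (1 - Q)ᴴ * (algebraMap ℝ _ (x - δ) - T) * (1 - Q) := by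
  obtain ⟨U, V, hUV, δ, hδ, hU, hV⟩ := exists_isCompl_of_forall_notMem_Icc_eigenvalues
    (Matrix.isSymmetric_toEuclideanLin_iff.2 hS) (Matrix.isSymmetric_toEuclideanLin_iff.2 hT)
    finrank_euclideanSpace (toEuclideanLin_le_toEuclideanLin_iff.2 hST) (x := x) (fun j => by
      simpa [Matrix.IsHermitian.eigenvalues, Matrix.IsHermitian.eigenvalues₀]
        using hx (Fintype.equivOfCardEq (Fintype.card_fin _) j))
  refine ⟨Matrix.toEuclideanLin.symm (U.projection V hUV), δ, hδ,
    conjTranspose_mul_mul_nonneg (hS.sub (isHermitian_algebraMap_real _)) _ fun v => ?_,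
    conjTranspose_mul_mul_nonneg ((isHermitian_algebraMap_real _).sub hT) _ fun v => ?_⟩
  · rw [LinearEquiv.apply_symm_apply, re_inner_toEuclideanLin_sub_algebraMap, sub_nonneg]
    exact hU _ (Submodule.projection_apply_mem _ _)
  · rw [← neg_sub T, map_neg, LinearMap.neg_apply, inner_neg_left, map_neg,
      re_inner_toEuclideanLin_sub_algebraMap, neg_sub, sub_nonneg, map_sub, Matrix.toLpLin_one,
      LinearEquiv.apply_symm_apply]
    exact hV _ (Submodule.sub_projection_mem hUV v)

end MatrixSplitting

section CStarAlgebra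

variable {A : Type*} [CStarAlgebra A] [PartialOrder A] [StarOrderedRing A]

theorem isUnit_of_splitting {a q : A} (ha : IsSelfAdjoint a) {δ : ℝ} (hδ : 0 < δ)
    (hq : 0 ≤ star q * (a - algebraMap ℝ A δ) * q)
    (hq' : 0 ≤ star (1 - q) * (-a - algebraMap ℝ A δ) * (1 - q)) : IsUnit a := by
  -- The reflection `r` swaps the sign of `a` on the second summand, so `star r * a + a * r` is
  -- bounded below, and then so is `a * a` because `ε • r - a` has a nonnegative square.
  set r := q - (1 - q) with hr
  have hlower : algebraMap ℝ A δ ≤ star r * a + a * r := by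
    have hrr : 0 ≤ δ • (star r * r) := smul_nonneg hδ.le (star_mul_self_nonneg r)
    have hsum := add_nonneg (nsmul_nonneg (add_nonneg hq hq') 2) hrr
    rw [← sub_nonneg]
    convert hsum using 1
    simp only [hr, Algebra.algebraMap_eq_smul_one, star_sub, star_one, sub_mul, mul_sub,
      smul_mul_assoc, mul_smul_comm, one_mul, mul_one, neg_mul, mul_neg]
    module
  obtain ⟨ε, hε, hgap⟩ : ∃ ε > 0, ε * ‖r‖ ^ 2 < δ := by
    refine ⟨δ / (‖r‖ ^ 2 + 1), by positivity, ?_⟩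
    rw [div_mul_eq_mul_div, div_lt_iff₀ (by positivity)]
    linarith
  have hsq : algebraMap ℝ A (ε * (δ - ε * ‖r‖ ^ 2)) ≤ a * a := by
    have hnorm := smul_le_smul_of_nonneg_left
      (CStarAlgebra.star_mul_le_algebraMap_norm_sq (a := r)) (sq_nonneg ε)
    have hlower' := smul_le_smul_of_nonneg_left hlower hε.le
    rw [← sub_nonneg] at hnorm hlower' ⊢
    convert add_nonneg (star_mul_self_nonneg (ε • r - a)) (add_nonneg hnorm hlower') using 1
    simp only [Algebra.algebraMap_eq_smul_one, star_sub, star_smul, ha.star_eq, sub_mul, mul_sub,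
      smul_mul_assoc, mul_smul_comm, star_trivial]
    module
  have hpos : IsStrictlyPositive (algebraMap ℝ A (ε * (δ - ε * ‖r‖ ^ 2))) :=
    isStrictlyPositive_algebraMap (mul_pos hε (sub_pos.2 hgap))
  exact isUnit_mul_self_iff.1 (CStarAlgebra.isUnit_of_le _ hsq hpos)

variable {κ : Type*} [Fintype κ] [DecidableEq κ] (π : Matrix κ κ ℂ →⋆ₐ[ℂ] A)
  {J : A} {S T : Matrix κ κ ℂ}

theorem spectrum_subset_iUnion_Icc_eigenvalues (hS : S.IsHermitian) (hT : T.IsHermitian)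
    (hST : S ≤ T) (hSJ : π S ≤ J) (hJT : J ≤ π T) :
    spectrum ℝ J ⊆ ⋃ j, Set.Icc (hS.eigenvalues j) (hT.eigenvalues j) := by
  intro x hx
  by_contra hout
  obtain ⟨Q, δ, hδ, hQ, hQ'⟩ := exists_splitting_of_forall_notMem_Icc_eigenvalues hS hT hST
    (x := x) (by simpa using hout)
  have hmap (c : ℝ) : π (algebraMap ℝ _ c) = algebraMap ℝ A c :=
    (π.toAlgHom.restrictScalars ℝ).commutes c
  have hJ : IsSelfAdjoint J := by
    have h1 : IsSelfAdjoint (J - π S) := .of_nonneg (sub_nonneg.2 hSJ)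
    have h2 : IsSelfAdjoint (π S) := hS.isSelfAdjoint.map π
    simpa using h1.add h2
  have hunit : IsUnit (J - algebraMap ℝ A x) := by
    refine isUnit_of_splitting (q := π Q) (hJ.sub (.algebraMap _ (.all x))) hδ ?_ ?_
    · have h := OrderHomClass.mono π hQ
      have h' := star_left_conjugate_le_conjugate
        (sub_le_sub_right hSJ (algebraMap ℝ A (x + δ))) (π Q)
      simp only [map_zero, map_mul, map_sub, hmap, ← Matrix.star_eq_conjTranspose, map_star] at h
      simpa only [sub_sub, map_add] using h.trans h'
    · have h := OrderHomClass.mono π hQ'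
      have h' := star_left_conjugate_le_conjugate
        (sub_le_sub_left hJT (algebraMap ℝ A (x - δ))) (π (1 - Q))
      simp only [map_zero, map_mul, map_sub, map_one, hmap, ← Matrix.star_eq_conjTranspose,
        map_star] at h h'
      convert h.trans h' using 3
      rw [neg_sub]
      abel
  exact spectrum.mem_iff.1 hx (by simpa using hunit.neg)

theorem volume_spectrum_le_trace_sub (hS : S.IsHermitian) (hT : T.IsHermitian)
    (hST : S ≤ T) (hSJ : π S ≤ J) (hJT : J ≤ π T) :
    volume (spectrum ℝ J) ≤ ENNReal.ofReal (T - S).trace.re := by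
  calc volume (spectrum ℝ J)
      ≤ volume (⋃ j, Set.Icc (hS.eigenvalues j) (hT.eigenvalues j)) :=
        measure_mono (spectrum_subset_iUnion_Icc_eigenvalues π hS hT hST hSJ hJT)
    _ ≤ ∑ j, volume (Set.Icc (hS.eigenvalues j) (hT.eigenvalues j)) := measure_iUnion_fintype_le _ _
    _ = ∑ j, ENNReal.ofReal (hT.eigenvalues j - hS.eigenvalues j) := by simp only [Real.volume_Icc]
    _ = ENNReal.ofReal (∑ j, (hT.eigenvalues j - hS.eigenvalues j)) :=
        (ENNReal.ofReal_sum_of_nonneg fun j _ =>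
          sub_nonneg.2 (matrix_eigenvalues_le_eigenvalues_of_le hS hT hST j)).symm
    _ = ENNReal.ofReal (T - S).trace.re := by
        simp [Matrix.trace_sub, hS.trace_eq_sum_eigenvalues, hT.trace_eq_sum_eigenvalues]

theorem volume_spectrum_le_of_commute {G X Y : Matrix κ κ ℂ} (hG : G.IsHermitian) {u J : A}
    (hu : star u * u = 1) (hcomm : ∀ M, Commute (π M) u)
    (hJ : J = π G + (π (Xᴴ * Y) * u + star (π (Xᴴ * Y) * u))) :
    volume (spectrum ℝ J) ≤ ENNReal.ofReal (2 * ((Xᴴ * X).trace.re + (Yᴴ * Y).trace.re)) := by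
  set D := Xᴴ * X + Yᴴ * Y with hD
  have hD0 : 0 ≤ D := add_nonneg (star_mul_self_nonneg X) (star_mul_self_nonneg Y)
  have hDH : D.IsHermitian := (IsSelfAdjoint.of_nonneg hD0).isHermitian
  -- `π D ± (π (Xᴴ * Y) * u + star (π (Xᴴ * Y) * u))` is the square `star (P ± Q) * (P ± Q)`.
  set P := π X
  set Q := π Y * u with hQ
  have hPQ : π (Xᴴ * Y) * u = star P * Q := by
    simp only [P, Q, map_mul, ← Matrix.star_eq_conjTranspose, map_star, mul_assoc]
  have hπD : π D = star P * P + star Q * Q := by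
    have : star Q * Q = star (π Y) * π Y := by
      rw [hQ, (hcomm Y).eq, star_mul, mul_assoc, ← mul_assoc _ u, hu, one_mul]
    simp only [this, hD, P, map_add, map_mul, ← Matrix.star_eq_conjTranspose, map_star]
  have hlower : π (G - D) ≤ J := by
    rw [← sub_nonneg]
    convert star_mul_self_nonneg (P + Q) using 1
    simp only [hJ, hPQ, map_sub, hπD, star_add, star_mul (star P), star_star]
    noncomm_ring
  have hupper : J ≤ π (G + D) := by
    rw [← sub_nonneg]
    convert star_mul_self_nonneg (P - Q) using 1
    simp only [hJ, hPQ, map_add, hπD, star_sub, star_mul (star P), star_star]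
    noncomm_ring
  have hGD : G - D ≤ G + D := (sub_le_self G hD0).trans (le_add_of_nonneg_right hD0)
  have htrace : (G + D - (G - D)).trace.re = 2 * ((Xᴴ * X).trace.re + (Yᴴ * Y).trace.re) := by
    rw [add_sub_sub_cancel, ← two_smul ℝ, hD]
    simp [mul_add]
  exact htrace ▸ volume_spectrum_le_trace_sub π (hG.sub hDH) (hG.add hDH) hGD hlower hupper

end CStarAlgebra

section Factorisation

open scoped ComplexOrder in
theorem exists_conjTranspose_mul_eq {𝕜 κ : Type*} [RCLike 𝕜] [Fintype κ] [DecidableEq κ]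
    (A : Matrix κ κ 𝕜) :
    ∃ X Y : Matrix κ κ 𝕜, Xᴴ * Y = A ∧ X * Xᴴ = CFC.sqrt (Aᴴ * A) ∧
      Yᴴ * Y = CFC.sqrt (Aᴴ * A) := by
  set R := CFC.sqrt (Aᴴ * A)
  have hR : 0 ≤ R := CFC.sqrt_nonneg _
  have hRR : R * R = Aᴴ * A := CFC.sqrt_mul_sqrt_self _ (star_mul_self_nonneg A)
  have hcont (f : ℝ → ℝ) : ContinuousOn f (spectrum ℝ R) :=
    Matrix.finite_real_spectrum.continuousOn f
  -- `Z` is the pseudo-inverse of `Y`, thanks to `0⁻¹ = 0`.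
  set Y := cfc Real.sqrt R
  set Z := cfc (fun t => (√t)⁻¹) R
  have hYH : Yᴴ = Y := (cfc_predicate Real.sqrt R : IsSelfAdjoint Y).star_eq
  have hZH : Zᴴ = Z := (cfc_predicate (fun t => (√t)⁻¹) R : IsSelfAdjoint Z).star_eq
  have hRH : Rᴴ = R := (IsSelfAdjoint.of_nonneg hR).star_eq
  have hYY : Y * Y = R := by
    rw [← cfc_mul _ _ R (hcont _) (hcont _)]
    exact (cfc_congr fun t ht => Real.mul_self_sqrt (spectrum_nonneg_of_nonneg hR ht)).trans
      (cfc_id' ℝ R)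
  have hRZ : R * Z = Y := by
    conv_lhs => rw [← cfc_id' ℝ R, ← cfc_mul _ _ R (hcont _) (hcont _)]
    exact cfc_congr fun t _ => Real.div_sqrt
  have hZR : Z * R = Y := by
    simpa only [Matrix.conjTranspose_mul, hZH, hRH, hYH] using congr(($hRZ)ᴴ)
  refine ⟨Z * Aᴴ, Y, ?_, ?_, by rw [hYH, hYY]⟩
  · have hker : A * (1 - Z * Y) = 0 := by
      have hRE : R * (1 - Z * Y) = 0 := by
        rw [mul_sub, mul_one, ← mul_assoc, hRZ, hYY, sub_self]
      rw [← Matrix.conjTranspose_mul_self_eq_zero, Matrix.conjTranspose_mul, mul_assoc,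
        ← mul_assoc Aᴴ, ← hRR, mul_assoc, hRE, mul_zero, mul_zero]
    rw [Matrix.conjTranspose_mul, Matrix.conjTranspose_conjTranspose, hZH, mul_assoc, eq_comm,
      ← sub_eq_zero, ← hker, mul_sub, mul_one]
  · rw [Matrix.conjTranspose_mul, Matrix.conjTranspose_conjTranspose, hZH, mul_assoc,
      ← mul_assoc Aᴴ, ← hRR, mul_assoc, hRZ, ← mul_assoc, hZR, hYY]

end Factorisation

section CellOperator

variable {m p : ℕ}

theorem star_weightedShift
    (T S : ℤ → (EuclideanSpace ℂ (Fin m) →L[ℂ] EuclideanSpace ℂ (Fin m))) (k : ℤ)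
    (hT : ∃ C, ∀ n, ‖T n‖ ≤ C) (hS : ∃ C, ∀ n, ‖S n‖ ≤ C) (hTS : ∀ n, S (n + k) = star (T n)) :
    star (weightedShift T k hT) = weightedShift S (-k) hS := by
  rw [ContinuousLinearMap.star_eq_adjoint, eq_comm, ContinuousLinearMap.eq_adjoint_iff]
  intro y z
  rw [← inner_conj_symm, ← inner_weightedShift T S k hT hS hTS, inner_conj_symm]

/-- The shift `y ↦ (n ↦ y (n + k))` of `ℓ²(ℤ, ℂᵐ)`. -/
noncomputable def shift (m : ℕ) (k : ℤ) : SeqSpace m →L[ℂ] SeqSpace m :=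
  weightedShift (fun _ => 1) k ⟨_, fun _ => le_rfl⟩

@[simp]
theorem shift_apply (k : ℤ) (y : SeqSpace m) (n : ℤ) : shift m k y n = y (n + k) := rfl

theorem star_shift_mul_shift (k : ℤ) : star (shift m k) * shift m k = 1 := by
  rw [shift, star_weightedShift _ (fun _ => 1) k _ ⟨_, fun _ => le_rfl⟩ fun _ => (star_one _).symm]
  ext y n : 3
  simp

variable [NeZero p] (N : ℤ)

theorem intCast_add_val_sub_val (n : ℤ) (j : ZMod p) :
    ((n + (j.val - ((n - N : ℤ) : ZMod p).val) - N : ℤ) : ZMod p) = j := by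
  push_cast [ZMod.natCast_zmod_val]
  ring

theorem apply_add_val_intCast_sub {α : Type*} {f : ℤ → α} (hf : Function.Periodic f (p : ℤ))
    (n : ℤ) : f (N + ((n - N : ℤ) : ZMod p).val) = f n := by
  rw [ZMod.val_intCast, Int.emod_def, mul_comm, ← add_sub_assoc, add_sub_cancel]
  exact hf.sub_zsmul_eq _

/-- The block diagonal operator on `ℓ²(ℤ, ℂᵐ)` that acts by the block matrix `M` on each of the
cells `{N + kp, …, N + kp + p - 1}`, `k ∈ ℤ`; the residue `i` indexes the site `N + kp + i.val`. -/
noncomputable def cellOperator (M : Matrix (ZMod p) (ZMod p) (Matrix (Fin m) (Fin m) ℂ)) :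
    SeqSpace m →L[ℂ] SeqSpace m :=
  ∑ i, ∑ j, weightedShift
    (fun n => if ((n - N : ℤ) : ZMod p) = i then Matrix.toEuclideanCLM (𝕜 := ℂ) (M i j) else 0)
    (j.val - i.val)
    (Function.Periodic.exists_norm_le (NeZero.pos p) fun n => by simp)

theorem cellOperator_apply (M : Matrix (ZMod p) (ZMod p) (Matrix (Fin m) (Fin m) ℂ))
    (y : SeqSpace m) (n : ℤ) :
    cellOperator N M y n = ∑ j, Matrix.toEuclideanCLM (𝕜 := ℂ) (M ((n - N : ℤ) : ZMod p) j)
      (y (n + (j.val - ((n - N : ℤ) : ZMod p).val))) := by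
  simp only [cellOperator, sum_apply, lp.coeFn_sum, Finset.sum_apply,
    weightedShift_apply]
  rw [Finset.sum_comm]
  refine Finset.sum_congr rfl fun j _ => ?_
  rw [Finset.sum_eq_single ((n - N : ℤ) : ZMod p) (fun i _ hi => ?_) (by simp), if_pos rfl]
  rw [if_neg hi.symm, zero_apply]

theorem cellOperator_mul (M L : Matrix (ZMod p) (ZMod p) (Matrix (Fin m) (Fin m) ℂ)) :
    cellOperator N (M * L) = cellOperator N M * cellOperator N L := by
  ext y n : 3
  simp only [mul_apply_eq_comp, cellOperator_apply, intCast_add_val_sub_val, map_sum,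
    Matrix.mul_apply, map_mul, sum_apply]
  rw [Finset.sum_comm]
  refine Finset.sum_congr rfl fun i _ => Finset.sum_congr rfl fun j _ => ?_
  rw [add_assoc, sub_add_sub_cancel']

theorem cellOperator_add (M L : Matrix (ZMod p) (ZMod p) (Matrix (Fin m) (Fin m) ℂ)) :
    cellOperator N (M + L) = cellOperator N M + cellOperator N L := by
  ext y n : 3
  simp only [cellOperator_apply, add_apply, lp.coeFn_add, Pi.add_apply, Matrix.add_apply, map_add,
    Finset.sum_add_distrib]

theorem cellOperator_diagonal {f : ℤ → Matrix (Fin m) (Fin m) ℂ}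
    (hf : Function.Periodic f (p : ℤ)) :
    cellOperator N (Matrix.diagonal fun i : ZMod p => f (N + i.val)) =
      weightedShift (fun n => Matrix.toEuclideanCLM (𝕜 := ℂ) (f n)) 0
        (Function.Periodic.exists_norm_le (NeZero.pos p) fun n => by rw [hf n]) := by
  ext y n : 3
  rw [cellOperator_apply, Finset.sum_eq_single ((n - N : ℤ) : ZMod p), Matrix.diagonal_apply_eq,
    apply_add_val_intCast_sub N hf, sub_self, weightedShift_apply]
  · intro j _ hj
    rw [Matrix.diagonal_apply_ne' _ hj, map_zero, zero_apply]
  · simp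

theorem cellOperator_algebraMap (c : ℂ) :
    cellOperator N (algebraMap ℂ (Matrix (ZMod p) (ZMod p) (Matrix (Fin m) (Fin m) ℂ)) c) =
      algebraMap ℂ _ c := by
  have hconst := cellOperator_diagonal (p := p) N
    (f := fun _ => algebraMap ℂ (Matrix (Fin m) (Fin m) ℂ) c) fun _ => rfl
  rw [Matrix.algebraMap_eq_diagonal]
  refine hconst.trans ?_
  ext y n : 3
  simp [Algebra.algebraMap_eq_smul_one]

theorem star_cellOperator (M : Matrix (ZMod p) (ZMod p) (Matrix (Fin m) (Fin m) ℂ)) :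
    star (cellOperator N M) = cellOperator N (star M) := by
  simp only [cellOperator, star_sum]
  rw [Finset.sum_comm]
  refine Finset.sum_congr rfl fun j _ => Finset.sum_congr rfl fun i _ => ?_
  rw [star_weightedShift _ (fun n => if ((n - N : ℤ) : ZMod p) = j then
    Matrix.toEuclideanCLM (𝕜 := ℂ) (star M j i) else 0) _ _
    (Function.Periodic.exists_norm_le (NeZero.pos p) fun n => by simp) fun n => ?_]
  · simp only [neg_sub]
  · have hiff : ((n + (j.val - i.val) - N : ℤ) : ZMod p) = j ↔ ((n - N : ℤ) : ZMod p) = i := by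
      push_cast [ZMod.natCast_zmod_val]
      rw [← sub_eq_zero, ← sub_eq_zero (b := i)]
      ring_nf
    simp only [hiff]
    split_ifs
    · rw [Matrix.star_apply, map_star]
    · exact (star_zero (EuclideanSpace ℂ (Fin m) →L[ℂ] EuclideanSpace ℂ (Fin m))).symm

variable (m p) in
/-- `cellOperator` as a `*`-homomorphism on matrices with scalar entries. -/
noncomputable def cellStarAlgHom :
    Matrix (ZMod p × Fin m) (ZMod p × Fin m) ℂ →⋆ₐ[ℂ] (SeqSpace m →L[ℂ] SeqSpace m) where
  toFun M := cellOperator N ((Matrix.compAlgEquiv _ _ ℂ ℂ).symm M)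
  map_one' := by
    rw [map_one, ← map_one (algebraMap ℂ _), cellOperator_algebraMap, map_one]
  map_mul' M L := by rw [map_mul, cellOperator_mul]
  map_zero' := by
    rw [map_zero, ← map_zero (algebraMap ℂ _), cellOperator_algebraMap, map_zero]
  map_add' M L := by rw [map_add, cellOperator_add]
  commutes' c := by rw [AlgEquiv.commutes, cellOperator_algebraMap]
  map_star' M := by rw [star_cellOperator]; rfl

theorem cellStarAlgHom_compAlgEquiv
    (M : Matrix (ZMod p) (ZMod p) (Matrix (Fin m) (Fin m) ℂ)) :
    cellStarAlgHom m p N (Matrix.compAlgEquiv _ _ ℂ ℂ M) = cellOperator N M :=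
  congrArg (cellOperator N) (AlgEquiv.symm_apply_apply _ M)

theorem commute_cellOperator_shift (M : Matrix (ZMod p) (ZMod p) (Matrix (Fin m) (Fin m) ℂ)) :
    Commute (cellOperator N M) (shift m p) := by
  ext y n : 3
  simp [cellOperator_apply, add_right_comm]

theorem zmod_val_add_one_of_ne_zero {i : ZMod p} (hi : i + 1 ≠ 0) : (i + 1).val = i.val + 1 := by
  have hcast : ((i.val + 1 : ℕ) : ZMod p) = i + 1 := by simp
  rw [← hcast, ZMod.val_natCast, Nat.mod_eq_of_lt]
  refine lt_of_le_of_ne i.val_lt fun h => hi ?_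
  rw [← hcast, h, ZMod.natCast_self]

theorem zmod_val_neg_one : ((-1 : ZMod p).val : ℤ) = p - 1 := by
  obtain ⟨q, rfl⟩ := Nat.exists_eq_succ_of_ne_zero (NeZero.ne p)
  simp [ZMod.val_neg_one]

/-- The block matrix of the couplings `f n : n + 1 ⟶ n` between neighbouring sites that lie in the
same cell; only the coupling `f (N - 1)` into the first site of a cell is left out. -/
def cellCoupling (f : ℤ → Matrix (Fin m) (Fin m) ℂ) :
    Matrix (ZMod p) (ZMod p) (Matrix (Fin m) (Fin m) ℂ) :=
  Matrix.of fun i j => if j = i + 1 ∧ i + 1 ≠ 0 then f (N + i.val) else 0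

theorem weightedShift_one_eq {f : ℤ → Matrix (Fin m) (Fin m) ℂ}
    (hf : Function.Periodic f (p : ℤ)) :
    weightedShift (fun n => Matrix.toEuclideanCLM (𝕜 := ℂ) (f n)) 1
        (Function.Periodic.exists_norm_le (NeZero.pos p) fun n => by rw [hf n]) =
      cellOperator N (cellCoupling (p := p) N f) +
        cellOperator N (Matrix.single (-1 : ZMod p) 0 (f (N - 1))) * shift m p := by
  ext y n : 3
  have hfi := apply_add_val_intCast_sub N hf n
  simp only [add_apply, lp.coeFn_add, Pi.add_apply, mul_apply_eq_comp, cellOperator_apply,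
    weightedShift_apply, cellCoupling, Matrix.of_apply, shift_apply, hfi]
  generalize ((n - N : ℤ) : ZMod p) = i at *
  by_cases hi : i + 1 = 0
  · obtain rfl := eq_neg_of_add_eq_zero_left hi
    have hfN : f (N - 1) = f n := by
      rw [← hfi, zmod_val_neg_one, ← hf (N - 1), sub_add_eq_add_sub, add_sub_assoc]
    have hsite : n + (((0 : ZMod p).val : ℤ) - (-1 : ZMod p).val) + p = n + 1 := by
      rw [zmod_val_neg_one, ZMod.val_zero]
      push_cast
      ring
    rw [Finset.sum_eq_zero fun j _ => by simp, zero_add,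
      Finset.sum_eq_single (0 : ZMod p) (fun j _ hj => by simp [hj.symm]) (by simp),
      Matrix.single_apply_same, hfN, hsite]
  · have hrow : -1 ≠ i := fun h => hi (by rw [← h, neg_add_cancel])
    have hsite : n + (((i + 1).val : ℤ) - i.val) = n + 1 := by
      rw [zmod_val_add_one_of_ne_zero hi, Nat.cast_succ, add_sub_cancel_left]
    rw [Finset.sum_eq_single (i + 1) (fun j _ hj => by simp [hj]) (by simp),
      Finset.sum_eq_zero fun j _ => by
        rw [Matrix.single_apply_of_row_ne hrow, map_zero, zero_apply],
      add_zero, if_pos ⟨rfl, hi⟩, hsite]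

variable {a b : ℤ → Matrix (Fin m) (Fin m) ℂ}

theorem jacobiOperator_eq (ha : Function.Periodic a (p : ℤ)) (hb : Function.Periodic b (p : ℤ)) :
    jacobiOperator p (NeZero.pos p) a b ha hb =
      cellOperator N (Matrix.diagonal (fun i => b (N + i.val)) +
          (cellCoupling (p := p) N a + star (cellCoupling (p := p) N a))) +
        (cellOperator N (Matrix.single (-1 : ZMod p) 0 (a (N - 1))) * shift m p +
          star (cellOperator N (Matrix.single (-1 : ZMod p) 0 (a (N - 1))) * shift m p)) := by
  have hstar := star_weightedShift (fun n => Matrix.toEuclideanCLM (𝕜 := ℂ) (a n))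
    (fun n => Matrix.toEuclideanCLM (𝕜 := ℂ) (a (n - 1))ᴴ) 1
    (Function.Periodic.exists_norm_le (NeZero.pos p) fun n => by rw [ha n])
    (Function.Periodic.exists_norm_le (NeZero.pos p) fun n => by
      rw [← ha (n - 1), sub_add_eq_add_sub])
    fun n => by rw [add_sub_cancel_right, ← Matrix.star_eq_conjTranspose, map_star]
  rw [jacobiOperator, ← hstar, ← cellOperator_diagonal N hb, weightedShift_one_eq N ha, star_add,
    star_cellOperator, cellOperator_add, cellOperator_add]
  abel

end CellOperator

section BlockMatrix

variable {R ι κ : Type*} [CommSemiring R] [Fintype ι] [DecidableEq ι] [Fintype κ] [DecidableEq κ]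

theorem trace_compAlgEquiv_single (i : ι) (A : Matrix κ κ R) :
    (Matrix.compAlgEquiv ι κ R R (Matrix.single i i A)).trace = A.trace := by
  simp only [Matrix.trace, Fintype.sum_prod_type, Matrix.diag_apply, Matrix.compAlgEquiv_apply]
  rw [Finset.sum_eq_single i (fun k _ hk => by simp [hk.symm]) (by simp)]
  simp

variable [StarRing R]

theorem conjTranspose_compAlgEquiv (M : Matrix ι ι (Matrix κ κ R)) :
    (Matrix.compAlgEquiv ι κ R R M)ᴴ = Matrix.compAlgEquiv ι κ R R (star M) := rfl

theorem conjTranspose_compAlgEquiv_single_mul_single (i j k : ι) (A B : Matrix κ κ R) :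
    (Matrix.compAlgEquiv ι κ R R (Matrix.single i j A))ᴴ *
        Matrix.compAlgEquiv ι κ R R (Matrix.single i k B) =
      Matrix.compAlgEquiv ι κ R R (Matrix.single j k (Aᴴ * B)) := by
  rw [conjTranspose_compAlgEquiv, Matrix.star_eq_conjTranspose, Matrix.conjTranspose_single,
    ← map_mul, Matrix.single_mul_single_same, Matrix.star_eq_conjTranspose]

end BlockMatrix

theorem spectrumMeasure_eq {m : ℕ} (J : SeqSpace m →L[ℂ] SeqSpace m) :
    spectrumMeasure J = volume (spectrum ℝ J) := by
  rw [spectrumMeasure, ← spectrum.preimage_algebraMap ℂ]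
  rfl

theorem spectrumMeasure_jacobiOperator_le {m p : ℕ} (hp : 0 < p)
    {a b : ℤ → Matrix (Fin m) (Fin m) ℂ}
    (ha : Function.Periodic a (p : ℤ)) (hb : Function.Periodic b (p : ℤ))
    (hb' : ∀ n, (b n).IsHermitian) (n : ℤ) :
    spectrumMeasure (jacobiOperator p hp a b ha hb) ≤ ENNReal.ofReal (4 * traceAbs (a n)) := by
  have : NeZero p := ⟨hp.ne'⟩
  obtain ⟨x, y, hxy, hx, hy⟩ := exists_conjTranspose_mul_eq (a n)
  let Φ := Matrix.compAlgEquiv (ZMod p) (Fin m) ℂ ℂ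
  let π := cellStarAlgHom m p (n + 1)
  have hπ (M) : π (Φ M) = cellOperator (n + 1) M := cellStarAlgHom_compAlgEquiv _ _
  set F := cellCoupling (p := p) (n + 1) a
  set D := Matrix.diagonal fun i : ZMod p => b (n + 1 + i.val)
  have hG : (Φ (D + (F + star F))).IsHermitian := by
    have hD : star D = D := by
      rw [Matrix.star_eq_conjTranspose, Matrix.diagonal_conjTranspose]
      exact congrArg Matrix.diagonal (funext fun i => hb' _)
    rw [Matrix.IsHermitian, conjTranspose_compAlgEquiv, star_add, star_add, star_star, hD,
      add_comm F]
  set X := Φ (Matrix.single 0 (-1) x)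
  set Y := Φ (Matrix.single 0 0 y)
  have hXY : Xᴴ * Y = Φ (Matrix.single (-1) 0 (a n)) := by
    rw [conjTranspose_compAlgEquiv_single_mul_single, hxy]
  have hJ : jacobiOperator p hp a b ha hb = π (Φ (D + (F + star F))) +
      (π (Xᴴ * Y) * shift m p + star (π (Xᴴ * Y) * shift m p)) := by
    rw [jacobiOperator_eq (n + 1) ha hb, hXY, hπ, hπ, add_sub_cancel_right]
  have hX : (Xᴴ * X).trace.re = traceAbs (a n) := by
    rw [conjTranspose_compAlgEquiv_single_mul_single, trace_compAlgEquiv_single,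
      Matrix.trace_mul_comm, hx, traceAbs]
  have hY : (Yᴴ * Y).trace.re = traceAbs (a n) := by
    rw [conjTranspose_compAlgEquiv_single_mul_single, trace_compAlgEquiv_single, hy, traceAbs]
  rw [spectrumMeasure_eq]
  refine (volume_spectrum_le_of_commute π hG (star_shift_mul_shift (p : ℤ))
    (fun M => commute_cellOperator_shift _ _) hJ).trans_eq ?_
  rw [hX, hY]
  ring_nf

section Sharpness

theorem eq_zero_of_norm_eq_of_tendsto {E : Type*} [NormedAddCommGroup E] {f : ℕ → E}
    (hf : ∀ n, ‖f (n + 1)‖ = ‖f n‖) (hlim : Filter.Tendsto f Filter.atTop (nhds 0)) : f 0 = 0 := by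
  have hconst (n) : ‖f n‖ = ‖f 0‖ := by
    induction n with
    | zero => rfl
    | succ n ih => rw [hf, ih]
  exact norm_eq_zero.1 <| tendsto_nhds_unique (tendsto_const_nhds.congr fun n => (hconst n).symm)
    (tendsto_zero_iff_norm_tendsto_zero.1 hlim)

theorem not_tendsto_cofinite_zero_of_recurrence {g : ℤ → ℂ} {z : ℂ} (hz : ‖z‖ = 1)
    (hg : ∀ n, (z + z⁻¹) * g n - (g (n - 1) + g (n + 1)) = if n = 0 then 1 else 0) :
    ¬ Filter.Tendsto g Filter.cofinite (nhds 0) := by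
  intro hlim
  have hz0 : z ≠ 0 := norm_ne_zero_iff.1 (hz.trans_ne one_ne_zero)
  let h (n : ℤ) : ℂ := g (n + 1) - z * g n
  have hstep (n) : h n = z⁻¹ * h (n - 1) - if n = 0 then 1 else 0 := by
    simp only [h, ← hg n, sub_add_cancel]
    field_simp
    ring
  have hnorm {n : ℤ} (hn : n ≠ 0) : ‖h n‖ = ‖h (n - 1)‖ := by
    rw [hstep, if_neg hn, sub_zero, norm_mul, norm_inv, hz, inv_one, one_mul]
  have hhlim : Filter.Tendsto h Filter.cofinite (nhds 0) := by
    simpa using (hlim.comp (add_left_injective 1).tendsto_cofinite).sub (hlim.const_mul z)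
  have hright : h 0 = 0 := by
    refine eq_zero_of_norm_eq_of_tendsto (f := fun n : ℕ => h n) (fun n => ?_)
      (Nat.cofinite_eq_atTop ▸ hhlim.comp Nat.cast_injective.tendsto_cofinite)
    rw [hnorm (by lia), Nat.cast_succ, add_sub_cancel_right]
  have hleft : h (-1) = 0 := by
    refine eq_zero_of_norm_eq_of_tendsto (f := fun n : ℕ => h (-1 - n)) (fun n => ?_)
      (Nat.cofinite_eq_atTop ▸
        hhlim.comp ((sub_right_injective (b := (-1 : ℤ))).comp
          Nat.cast_injective).tendsto_cofinite)
    rw [hnorm (n := -1 - n) (by lia), Nat.cast_succ, sub_sub]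
  simpa [hright, hleft] using hstep 0

theorem tendsto_seqSpace_cofinite_zero {m : ℕ} (v : SeqSpace m) :
    Filter.Tendsto (fun n => v n) Filter.cofinite (nhds 0) := by
  have hsq := (lp.hasSum_norm (by norm_num) v).summable.tendsto_cofinite_zero.sqrt
  rw [tendsto_zero_iff_norm_tendsto_zero]
  simpa [Real.sqrt_sq (norm_nonneg _)] using hsq

theorem exists_norm_eq_one_add_inv_eq {t : ℝ} (ht : |t| ≤ 2) : ∃ z : ℂ, ‖z‖ = 1 ∧ z + z⁻¹ = t := by
  obtain ⟨h₁, h₂⟩ := abs_le.1 ht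
  refine ⟨Complex.exp (Real.arccos (t / 2) * Complex.I), Complex.norm_exp_ofReal_mul_I _, ?_⟩
  rw [← Complex.exp_neg, ← neg_mul, ← Complex.two_cos, ← Complex.ofReal_cos,
    Real.cos_arccos (by linarith) (by linarith)]
  push_cast
  ring

theorem traceAbs_one (m : ℕ) : traceAbs (1 : Matrix (Fin m) (Fin m) ℂ) = m := by
  simp [traceAbs, CFC.sqrt_one]

theorem exists_abs_sub_four_mul_le {m : ℕ} {x : ℝ} (hx : x ∈ Set.Ioc (2 : ℝ) (4 * m + 2)) :
    ∃ k : Fin m, |x - 4 * (k + 1)| ≤ 2 := by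
  obtain ⟨hx₁, hx₂⟩ := hx
  have hpos : 0 < ⌈(x - 2) / 4⌉₊ := Nat.ceil_pos.2 (by linarith)
  have hle : ⌈(x - 2) / 4⌉₊ ≤ m := Nat.ceil_le.2 (by linarith)
  have hlt := Nat.ceil_lt_add_one (show 0 ≤ (x - 2) / 4 by linarith)
  have hge := Nat.le_ceil ((x - 2) / 4)
  refine ⟨⟨⌈(x - 2) / 4⌉₊ - 1, by lia⟩, ?_⟩
  rw [Nat.cast_sub hpos, Nat.cast_one, abs_le]
  constructor <;> linarith

variable {m p : ℕ} (hp : 0 < p) {a b : ℤ → Matrix (Fin m) (Fin m) ℂ}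
  (ha : Function.Periodic a (p : ℤ)) (hb : Function.Periodic b (p : ℤ)) (ha1 : ∀ n, a n = 1)

include ha1

theorem add_ofReal_mem_spectrum_jacobiOperator {d : Fin m → ℂ}
    (hbd : ∀ n, b n = Matrix.diagonal d) (k : Fin m) {t : ℝ} (ht : |t| ≤ 2) :
    d k + t ∈ spectrum ℂ (jacobiOperator p hp a b ha hb) := by
  obtain ⟨z, hz, hzt⟩ := exists_norm_eq_one_add_inv_eq ht
  set J := jacobiOperator p hp a b ha hb
  -- The `k`-th component of a preimage of `δ₀ ⊗ eₖ` under `d k + t - J` cannot decay.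
  intro hunit
  set δ : SeqSpace m := lp.single 2 (0 : ℤ) (EuclideanSpace.single k (1 : ℂ))
  obtain ⟨v, hv⟩ := (ContinuousLinearMap.isUnit_iff_bijective.1 hunit).2 δ
  have hlim : Filter.Tendsto (fun n => v n k) Filter.cofinite (nhds 0) :=
    squeeze_zero_norm (fun n => PiLp.norm_apply_le (v n) k)
      (tendsto_zero_iff_norm_tendsto_zero.1 (tendsto_seqSpace_cofinite_zero v))
  refine not_tendsto_cofinite_zero_of_recurrence hz (fun n => ?_) hlim
  have hJv : J v n k = v (n - 1) k + d k * v n k + v (n + 1) k := by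
    have := congrFun (jacobiOperator_apply p hp a b ha hb v n) k
    rw [ha1, ha1, hbd] at this
    simpa [Matrix.mulVec_diagonal] using this
  have hδ : δ n k = if n = 0 then 1 else 0 := by
    by_cases hn : n = 0
    · subst hn; simp [δ]
    · simp [δ, hn]
  have hres : δ n k = (d k + t) * v n k - J v n k := by
    rw [← hv, Algebra.algebraMap_eq_smul_one]
    rfl
  rw [← hδ, hres, hJv, hzt]
  ring

theorem ofReal_four_mul_le_spectrumMeasure_jacobiOperator
    (hbd : ∀ n, b n = Matrix.diagonal fun k : Fin m => 4 * ((k : ℂ) + 1)) :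
    ENNReal.ofReal (4 * m) ≤ spectrumMeasure (jacobiOperator p hp a b ha hb) := by
  have hsub : Set.Ioc (2 : ℝ) (4 * m + 2) ⊆
      {x : ℝ | (x : ℂ) ∈ spectrum ℂ (jacobiOperator p hp a b ha hb)} := by
    intro x hx
    obtain ⟨k, hk⟩ := exists_abs_sub_four_mul_le hx
    convert add_ofReal_mem_spectrum_jacobiOperator hp ha hb ha1 hbd k hk
    push_cast
    ring
  calc ENNReal.ofReal (4 * m) = volume (Set.Ioc (2 : ℝ) (4 * m + 2)) := by
        rw [Real.volume_Ioc, add_sub_cancel_right]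
    _ ≤ _ := measure_mono hsub

end Sharpness

/- The infimum below runs over the values of a periodic sequence, hence it is a minimum. The index
`k : Fin m` of the diagonal counts from `0`, so that the diagonal entries are `4, 8, …, 4m`. -/
theorem theorem1p2 :
    (∀ (m p : ℕ) (hp : 0 < p) (a b : ℤ → Matrix (Fin m) (Fin m) ℂ)
      (ha : Function.Periodic a (p : ℤ)) (hb : Function.Periodic b (p : ℤ)),
      (∀ n, (b n).IsHermitian) →
      spectrumMeasure (jacobiOperator p hp a b ha hb) ≤
        ⨅ n : ℤ, ENNReal.ofReal (4 * traceAbs (a n))) ∧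
    (∀ (m p : ℕ) (hp : 0 < p) (a b : ℤ → Matrix (Fin m) (Fin m) ℂ)
      (ha : Function.Periodic a (p : ℤ)) (hb : Function.Periodic b (p : ℤ)),
      (∀ n, a n = 1) →
      (∀ n, b n = Matrix.diagonal fun k : Fin m => 4 * ((k : ℂ) + 1)) →
      spectrumMeasure (jacobiOperator p hp a b ha hb) =
        ⨅ n : ℤ, ENNReal.ofReal (4 * traceAbs (a n))) := by
  refine ⟨fun m p hp a b ha hb hb' => le_iInf fun n =>
    spectrumMeasure_jacobiOperator_le hp ha hb hb' n, fun m p hp a b ha hb ha1 hbd => le_antisymm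
    (le_iInf fun n => spectrumMeasure_jacobiOperator_le hp ha hb (fun k => ?_) n) ?_⟩
  · rw [hbd, Matrix.isHermitian_diagonal_iff]
    exact fun j => by simp [isSelfAdjoint_iff]
  · refine (iInf_le _ 0).trans ?_
    rw [ha1, traceAbs_one]
    exact ofReal_four_mul_le_spectrumMeasure_jacobiOperator hp ha hb ha1 hbd
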